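/- Fix $\hbar\neq 0$, a $2n$-dimensional real symplectic vector space $(V,\Omega)$ with symplectic group $\mathrm{Sp}(V)$, the metaplectic group $\mathrm{Mp}(V)$ (the connected double cover of $\mathrm{Sp}(V)$), and the metaplectic-c group $\mathrm{Mp}^c(V)=\mathrm{Mp}(V)\times_{\mathbb Z_2}U(1)$ (for $n=0$ put $\mathrm{Mp}^c(V)=U(1)$), with the homomorphisms $\sigma:\mathrm{Mp}^c(V)\to\mathrm{Sp}(V)$, induced by the covering map, and $\eta:\mathrm{Mp}^c(V)\to U(1)$, $\eta([x,\lambda])=\lambda^2$. For a $2n$-dimensional symplectic manifold $(M,\omega)$ let $\rho:\mathrm{Sp}(M,\omega)\to M$ be its symplectic frame bundle, with fibres $\{b:V\to T_mM \text{ linear isomorphism},\ b^*\omega_m=\Omega\}$ and right action $b\cdot g=b\circ g$ of $\mathrm{Sp}(V)$. A metaplectic-c prequantization of $(M,\omega)$ is a triple $(P,\Sigma,\gamma)$, where $\Pi:P\to M$ is a smooth right principal $\mathrm{Mp}^c(V)$-bundle, $\Sigma:P\to\mathrm{Sp}(M,\omega)$ is a smooth map with $\rho\circ\Sigma=\Pi$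 and $\Sigma(q\cdot a)=\Sigma(q)\cdot\sigma(a)$ for all $q\in P$, $a\in\mathrm{Mp}^c(V)$, and $\gamma$ is a smooth $\mathfrak u(1)$-valued one-form on $P$ such that 1. $\gamma$ is invariant under the action of $\mathrm{Mp}^c(V)$; 2. $\gamma(\hat\partial_\alpha)=\frac12\eta_*\alpha$ for all $\alpha\in\mathfrak{mp}^c(V)$, where $\hat\partial_\alpha$ is the vector field on $P$ with flow $q\mapsto q\cdot\exp(t\alpha)$; 3. $d\gamma=\frac{1}{i\hbar}\Pi^*\omega$. Let $(P_1,\Sigma_1,\gamma_1)$ and $(P_2,\Sigma_2,\gamma_2)$ be metaplectic-c prequantizations (for the same $(V,\Omega)$ and $\hbar$) of $2n$-dimensional symplectic manifolds $(M_1,\omega_1)$ and $(M_2,\omega_2)$, with bundle projections $\Pi_j:P_j\to M_j$, and let $K:P_1\to P_2$ be a diffeomorphism such that $K^*\gamma_2=\gamma_1$. Then there is a unique map $K'':M_1\to M_2$ with $\Pi_2\circ K=K''\circ\Pi_1$; it is a diffeomorphism, and it is a symplectomorphism, that is, $K''^*\omega_2=\omega_1$. -/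

import Mathlib

open scoped Manifold ContDiff Topology

theorem isLocalHomeomorph_of_comp_quotient {X Y Z : Type*} [TopologicalSpace X] [TopologicalSpace Y]
    [TopologicalSpace Z] {q : X → Y} {h : Y → Z} (hq : Continuous q) (hqo : IsOpenMap q)
    (hqs : Function.Surjective q) (hh : Continuous h) (hc : IsLocalHomeomorph (h ∘ q)) :
    IsLocalHomeomorph h := by
  rw [isLocalHomeomorph_iff_isOpenEmbedding_restrict]
  intro y
  obtain ⟨x, rfl⟩ := hqs y
  obtain ⟨e, hx, he⟩ := hc x
  refine ⟨q '' e.source, (hqo _ e.open_source).mem_nhds ⟨x, hx, rfl⟩, ?_⟩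
  refine Topology.IsOpenEmbedding.of_continuous_injective_isOpenMap
    (hh.comp continuous_subtype_val) ?_ ?_
  · rintro ⟨_, u, hu, rfl⟩ ⟨_, v, hv, rfl⟩ huv
    have : e u = e v := by
      have h1 := congrFun he u
      have h2 := congrFun he v
      simp only [Function.comp_apply] at h1 h2
      rw [← h1, ← h2]
      exact huv
    exact Subtype.ext (congrArg q (e.injOn hu hv this))
  · have hV : IsOpen (q '' e.source) := hqo _ e.open_source
    intro W hW
    have hW' : IsOpen ((↑) '' W : Set Y) := hV.isOpenMap_subtype_val _ hW
    have : (q '' e.source).domRestrict h '' W = e '' (e.source ∩ q ⁻¹' ((↑) '' W)) := by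
      ext z
      constructor
      · rintro ⟨⟨_, u, hu, rfl⟩, hw, rfl⟩
        exact ⟨u, ⟨hu, ⟨_, hw, rfl⟩⟩, (congrFun he u).symm⟩
      · rintro ⟨u, ⟨hu, ⟨w, hw, hwu⟩⟩, rfl⟩
        refine ⟨w, hw, ?_⟩
        rw [← he]
        exact congrArg h hwu
    rw [this]
    exact e.isOpen_image_of_subset_source (e.open_source.inter (hW'.preimage hq) ) Set.inter_subset_left

/-- A continuous homomorphism of topological groups that is open and injective near `1` is a
local homeomorphism. -/
theorem MonoidHom.isLocalHomeomorph_of_nhds_one {G H : Type*} [Group G] [TopologicalSpace G]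
    [IsTopologicalGroup G] [Group H] [TopologicalSpace H] [IsTopologicalGroup H] (f : G →* H)
    (hf : Continuous f) (ho : 𝓝 1 ≤ (𝓝 1).map f) (W : Set G) (hW : W ∈ 𝓝 (1 : G))
    (hi : Set.InjOn f W) : IsLocalHomeomorph f := by
  have hop : IsOpenMap f := IsTopologicalGroup.isOpenMap_iff_nhds_one.2 ho
  rw [isLocalHomeomorph_iff_isOpenEmbedding_restrict]
  intro g
  obtain ⟨U, hUW, hU, h1⟩ := mem_nhds_iff.1 hW
  have hgU : IsOpen ((fun x => g⁻¹ * x) ⁻¹' U) := hU.preimage (continuous_const.mul continuous_id)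
  refine ⟨(fun x => g⁻¹ * x) ⁻¹' U, hgU.mem_nhds (by simpa using h1), ?_⟩
  refine Topology.IsOpenEmbedding.of_continuous_injective_isOpenMap
    (hf.comp continuous_subtype_val) ?_ (hop.comp hgU.isOpenMap_subtype_val)
  rintro ⟨x, hx⟩ ⟨y, hy⟩ hxy
  have : g⁻¹ * x = g⁻¹ * y := hi (hUW hx) (hUW hy) (by
    have : f x = f y := hxy
    simp [this])
  simpa using this

theorem isLocalHomeomorph_circle_sq : IsLocalHomeomorph (fun z : Circle => z ^ 2) := by
  refine isLocalHomeomorph_of_comp_quotient (q := Circle.exp) Circle.exp.continuous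
    isLocalHomeomorph_circleExp.isOpenMap Circle.isAddQuotientCoveringMap_exp.surjective
    (by fun_prop) ?_
  have : (fun z : Circle => z ^ 2) ∘ Circle.exp = Circle.exp ∘ (Homeomorph.mulLeft₀ (2 : ℝ) two_ne_zero) := by
    ext x
    simp [two_mul, Circle.exp_add, sq]
  rw [this]
  exact isLocalHomeomorph_circleExp.comp (Homeomorph.isLocalHomeomorph _)

theorem IsLocalHomeomorph.prodMap' {X Y X' Y' : Type*} [TopologicalSpace X] [TopologicalSpace Y]
    [TopologicalSpace X'] [TopologicalSpace Y'] {f : X → Y} {g : X' → Y'}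
    (hf : IsLocalHomeomorph f) (hg : IsLocalHomeomorph g) : IsLocalHomeomorph (Prod.map f g) := by
  rintro ⟨x, x'⟩
  obtain ⟨e, hx, rfl⟩ := hf x
  obtain ⟨e', hx', rfl⟩ := hg x'
  exact ⟨e.prod e', ⟨hx, hx'⟩, rfl⟩

section Lift
variable {X Y H : Type*} [TopologicalSpace X] [TopologicalSpace Y] [TopologicalSpace H]
  [ChartedSpace H Y]

/-- The charted space structure for which the local homeomorphism `f` is a local diffeomorphism:
its charts are the charts of the target composed with local restrictions of `f`. -/
noncomputable abbrev IsLocalHomeomorph.liftChartedSpace {f : X → Y} (hf : IsLocalHomeomorph f) : ChartedSpace H X where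
  atlas := {e | ∃ x, e = (hf x).choose.trans (chartAt H (f x))}
  chartAt x := (hf x).choose.trans (chartAt H (f x))
  mem_chart_source x := by
    have h := (hf x).choose_spec
    refine ⟨h.1, ?_⟩
    rw [Set.mem_preimage]
    convert mem_chart_source H (f x) using 1
    exact (congrFun h.2 x).symm
  chart_mem_atlas x := ⟨x, rfl⟩

theorem IsLocalHomeomorph.lift_isManifold {E : Type*} [NormedAddCommGroup E] [NormedSpace ℝ E]
    (I : ModelWithCorners ℝ E H) (n : ℕ∞ω) [IsManifold I n Y] {f : X → Y}
    (hf : IsLocalHomeomorph f) :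
    let _ := hf.liftChartedSpace (H := H); IsManifold I n X := by
  let _ := hf.liftChartedSpace (H := H)
  refine @IsManifold.mk _ _ _ _ _ _ _ _ _ _ _ _ ⟨?_⟩
  rintro _ _ ⟨x, rfl⟩ ⟨y, rfl⟩
  obtain ⟨hx, hfx⟩ := (hf x).choose_spec
  obtain ⟨hy, hfy⟩ := (hf y).choose_spec
  set e := (hf x).choose
  set e' := (hf y).choose
  set c := chartAt H (f x)
  set c' := chartAt H (f y)
  have h0 : c.symm.trans c' ∈ contDiffGroupoid n I :=
    StructureGroupoid.compatible _ (chart_mem_atlas H _) (chart_mem_atlas H _)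
  set T := (e.trans c).symm.trans (e'.trans c')
  have h1 := (closedUnderRestriction' (G := contDiffGroupoid n I) h0 T.open_source)
  refine (contDiffGroupoid n I).mem_of_eqOnSource h1 ?_
  have key : ∀ z ∈ e.target, e' (e.symm z) = z := by
    intro z hz
    have a := congrFun hfx (e.symm z)
    have b := congrFun hfy (e.symm z)
    rw [← b, a, e.right_inv hz]
  have hsub : ∀ z ∈ T.source, z ∈ (c.symm.trans c').source := by
    intro z hz
    simp only [T, mfld_simps] at hz ⊢
    refine ⟨hz.1.1, ?_⟩
    have := hz.2.2
    rwa [key _ hz.1.2] at this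
  constructor
  · rw [OpenPartialHomeomorph.restr_source, T.open_source.interior_eq]
    exact (Set.inter_eq_right.2 hsub).symm
  · intro z hz
    have hz' := hz
    simp only [T, mfld_simps] at hz' ⊢
    rw [key _ hz'.1.2]
end Lift

section SymplecticGroup

variable {V : Type*} [NormedAddCommGroup V] [NormedSpace ℝ V]

theorem form_add_left (Ω : V [⋀^Fin 2]→L[ℝ] ℝ) (a b c : V) :
    Ω ![a + b, c] = Ω ![a, c] + Ω ![b, c] := Ω.vecCons_add ![c] a b

theorem form_swap (Ω : V [⋀^Fin 2]→L[ℝ] ℝ) (a b : V) : Ω ![a, b] = -Ω ![b, a] := by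
  have h := Ω.map_swap ![b, a] (i := 0) (j := 1) (by decide)
  have e : ![b, a] ∘ Equiv.swap (0 : Fin 2) 1 = ![a, b] := by
    ext i
    fin_cases i <;> simp
  rw [e] at h
  exact h

theorem form_add_right (Ω : V [⋀^Fin 2]→L[ℝ] ℝ) (a b c : V) :
    Ω ![a, b + c] = Ω ![a, b] + Ω ![a, c] := by
  rw [form_swap, form_add_left, form_swap Ω a b, form_swap Ω a c]; ring

theorem form_smul_left (Ω : V [⋀^Fin 2]→L[ℝ] ℝ) (r : ℝ) (a c : V) :
    Ω ![r • a, c] = r * Ω ![a, c] := Ω.vecCons_smul ![c] r a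

theorem form_smul_right (Ω : V [⋀^Fin 2]→L[ℝ] ℝ) (r : ℝ) (a c : V) :
    Ω ![a, r • c] = r * Ω ![a, c] := by
  rw [form_swap, form_smul_left, form_swap Ω a c]; ring

theorem form_sub_left (Ω : V [⋀^Fin 2]→L[ℝ] ℝ) (a b c : V) :
    Ω ![a - b, c] = Ω ![a, c] - Ω ![b, c] := by
  have := form_add_left Ω (a - b) b c
  simp only [sub_add_cancel] at this
  linarith

theorem form_sub_right (Ω : V [⋀^Fin 2]→L[ℝ] ℝ) (a b c : V) :
    Ω ![a, b - c] = Ω ![a, b] - Ω ![a, c] := by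
  have := form_add_right Ω a (b - c) c
  simp only [sub_add_cancel] at this
  linarith

/-- The symplectic group `Sp(V)` of `(V, Ω)`: the invertible linear endomorphisms of `V` that
preserve `Ω`, with the topology of the operator norm. -/
def Sp (Ω : V [⋀^Fin 2]→L[ℝ] ℝ) : Subgroup (V →L[ℝ] V)ˣ where
  carrier := {g | ∀ v w, Ω ![g.1 v, g.1 w] = Ω ![v, w]}
  mul_mem' := by
    intro g h hg hh v w
    simpa using (hg (h.1 v) (h.1 w)).trans (hh v w)
  one_mem' := by intro v w; simp
  inv_mem' := by
    intro g hg v w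
    have hv : ∀ x, g.1 (g⁻¹.1 x) = x := fun x => by
      rw [← mul_apply_eq_comp, ← Units.val_mul]; simp
    rw [← hg (g⁻¹.1 v) (g⁻¹.1 w), hv, hv]

/-- The Lie algebra `𝔰𝔭(V)`: the infinitesimal symplectic endomorphisms of `(V, Ω)`. -/
def spAlg (Ω : V [⋀^Fin 2]→L[ℝ] ℝ) : Submodule ℝ (V →L[ℝ] V) where
  carrier := {X | ∀ v w, Ω ![X v, w] + Ω ![v, X w] = 0}
  add_mem' := by
    intro X Y hX hY v w
    simp only [add_apply, form_add_left, form_add_right]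
    linarith [hX v w, hY v w]
  zero_mem' := by
    intro v w
    have h1 := form_smul_left Ω 0 0 w
    have h2 := form_smul_right Ω 0 v 0
    simp_all
  smul_mem' := by
    intro r X hX v w
    simp only [smul_apply, form_smul_left, form_smul_right]
    linear_combination r * hX v w

variable (Ω : V [⋀^Fin 2]→L[ℝ] ℝ)

theorem cayley_mem (g : Sp Ω) :
    (g.1.1 - 1) * Ring.inverse (g.1.1 + 1) ∈ spAlg Ω := by
  by_cases h : IsUnit (g.1.1 + 1)
  · obtain ⟨u, hu⟩ := h
    rw [← hu, Ring.inverse_unit]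
    intro v w
    have key : ∀ x, g.1.1 (u⁻¹.1 x) + u⁻¹.1 x = x := fun x => by
      have := congrArg (fun T : V →L[ℝ] V => T x) u.mul_inv
      rw [hu] at this
      simpa using this
    have hg := g.2 (u⁻¹.1 v) (u⁻¹.1 w)
    simp only [mul_apply_eq_comp, sub_apply,
      one_apply_eq_self]
    obtain ⟨a, ha⟩ : ∃ a, a = u⁻¹.1 v := ⟨_, rfl⟩
    obtain ⟨b, hb⟩ : ∃ b, b = u⁻¹.1 w := ⟨_, rfl⟩
    have k1 := key v
    have k2 := key w
    rw [← ha] at hg k1 ⊢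
    rw [← hb] at hg k2 ⊢
    rw [← k1, ← k2]
    simp only [form_add_left, form_add_right, form_sub_left, form_sub_right]
    linear_combination 2 * hg
  · rw [Ring.inverse_non_unit _ h, mul_zero]
    exact zero_mem _

theorem cayleyInv_mem {X : V →L[ℝ] V} (hX : X ∈ spAlg Ω) (a b : (V →L[ℝ] V)ˣ)
    (ha : a.1 = 1 + X) (hb : b.1 = 1 - X) : a * b⁻¹ ∈ Sp Ω := by
  have h1 : ∀ v w, Ω ![a.1 v, a.1 w] = Ω ![b.1 v, b.1 w] := by
    intro v w
    rw [ha, hb]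
    simp only [add_apply, sub_apply,
      one_apply_eq_self, form_add_left, form_add_right, form_sub_left, form_sub_right]
    linear_combination 2 * hX v w
  intro v w
  have hv : ∀ x, b.1 (b⁻¹.1 x) = x := fun x => by
    rw [← mul_apply_eq_comp, ← Units.val_mul]; simp
  have := h1 (b⁻¹.1 v) (b⁻¹.1 w)
  rw [hv, hv] at this
  simpa using this

open Classical in
/-- The inverse Cayley transform `X ↦ (1 + X) (1 - X)⁻¹` (with value `1` where undefined). -/
noncomputable def cayleyInv (X : spAlg Ω) : Sp Ω :=
  if h : IsUnit (1 + X.1) ∧ IsUnit (1 - X.1) then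
    ⟨h.1.unit * h.2.unit⁻¹, cayleyInv_mem Ω X.2 _ _ rfl rfl⟩ else 1

theorem cayleyInv_val {X : spAlg Ω} (h : IsUnit (1 + X.1) ∧ IsUnit (1 - X.1)) :
    (cayleyInv Ω X).1.1 = (1 + X.1) * Ring.inverse (1 - X.1) := by
  rw [cayleyInv, dif_pos h]
  have : Ring.inverse (1 - X.1) = h.2.unit⁻¹.1 := by
    rw [← Ring.inverse_unit]; rfl
  rw [this]
  rfl

theorem isUnit_two : IsUnit (2 : V →L[ℝ] V) := by
  have h := (IsUnit.mk0 (2 : ℝ) two_ne_zero).map (algebraMap ℝ (V →L[ℝ] V))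
  rwa [map_ofNat] at h

theorem cayley_aux {A : Type*} [Ring A] {g : A} {u : Aˣ} (hu : u.1 = g + 1) :
    1 + (g - 1) * u⁻¹.1 = 2 * (g * u⁻¹.1) ∧ 1 - (g - 1) * u⁻¹.1 = 2 * u⁻¹.1 := by
  have h : g * u⁻¹.1 + u⁻¹.1 = 1 := by
    have := u.mul_inv
    rw [hu] at this
    rw [← this]
    noncomm_ring
  constructor
  · nth_rewrite 1 [← h]; noncomm_ring
  · nth_rewrite 1 [← h]; noncomm_ring

theorem cayleyInv_aux {A : Type*} [Ring A] {X : A} {b : Aˣ} (hb : b.1 = 1 - X) :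
    (1 + X) * b⁻¹.1 + 1 = 2 * b⁻¹.1 ∧ (1 + X) * b⁻¹.1 - 1 = X * (2 * b⁻¹.1) := by
  have h : b⁻¹.1 - X * b⁻¹.1 = 1 := by
    have := b.mul_inv
    rw [hb] at this
    rw [← this]
    noncomm_ring
  constructor
  · nth_rewrite 2 [← h]; noncomm_ring
  · nth_rewrite 2 [← h]; noncomm_ring

/-- The Cayley transform `g ↦ (g - 1) (g + 1)⁻¹`, a homeomorphism from the open set
`{g | g + 1 invertible}` of `Sp(V)` onto an open subset of `𝔰𝔭(V)`. -/
noncomputable def cayley [FiniteDimensional ℝ V] : OpenPartialHomeomorph (Sp Ω) (spAlg Ω) where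
  toFun g := ⟨(g.1.1 - 1) * Ring.inverse (g.1.1 + 1), cayley_mem Ω g⟩
  invFun := cayleyInv Ω
  source := {g | IsUnit (g.1.1 + 1)}
  target := {X | IsUnit (1 + X.1) ∧ IsUnit (1 - X.1)}
  map_source' := by
    rintro g ⟨u, hu⟩
    have i2 := isUnit_two (V := V)
    simp only [Set.mem_ofPred_eq]
    rw [← hu, Ring.inverse_unit]
    obtain ⟨h1, h2⟩ := cayley_aux hu
    rw [h1, h2]
    exact ⟨i2.mul (g.1.isUnit.mul u⁻¹.isUnit), i2.mul u⁻¹.isUnit⟩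
  map_target' := by
    intro X hX
    obtain ⟨b, hb⟩ := hX.2
    simp only [Set.mem_ofPred_eq]
    rw [cayleyInv_val Ω hX, ← hb, Ring.inverse_unit]
    rw [(cayleyInv_aux hb).1]
    exact isUnit_two.mul b⁻¹.isUnit
  left_inv' := by
    rintro g ⟨u, hu⟩
    have hi : IsUnit (1 + (g.1.1 - 1) * Ring.inverse (g.1.1 + 1)) ∧
        IsUnit (1 - (g.1.1 - 1) * Ring.inverse (g.1.1 + 1)) := by
      have i2 := isUnit_two (V := V)
      rw [← hu, Ring.inverse_unit]
      obtain ⟨h1, h2⟩ := cayley_aux hu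
      rw [h1, h2]
      exact ⟨i2.mul (g.1.isUnit.mul u⁻¹.isUnit), i2.mul u⁻¹.isUnit⟩
    apply Subtype.ext
    apply Units.ext
    rw [cayleyInv_val Ω hi]
    have h3 : (1 + (g.1.1 - 1) * Ring.inverse (g.1.1 + 1)) =
        g.1.1 * (1 - (g.1.1 - 1) * Ring.inverse (g.1.1 + 1)) := by
      rw [← hu, Ring.inverse_unit]
      obtain ⟨h1, h2⟩ := cayley_aux hu
      rw [h1, h2]; noncomm_ring
    rw [h3, mul_assoc, Ring.mul_inverse_cancel _ hi.2, mul_one]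
  right_inv' := by
    intro X hX
    apply Subtype.ext
    simp only
    rw [cayleyInv_val Ω hX]
    obtain ⟨b, hb⟩ := hX.2
    rw [← hb, Ring.inverse_unit]
    obtain ⟨h1, h2⟩ := cayleyInv_aux hb
    rw [h1, h2, mul_assoc, Ring.mul_inverse_cancel _ (isUnit_two.mul b⁻¹.isUnit), mul_one]
  open_source := by
    have := FiniteDimensional.complete ℝ V
    refine Units.isOpen.preimage (f := fun g : Sp Ω => g.1.1 + 1) ?_
    exact (Units.continuous_val.comp continuous_subtype_val).add continuous_const
  open_target := by
    have := FiniteDimensional.complete ℝ V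
    refine (Units.isOpen.preimage (f := fun X : spAlg Ω => 1 + X.1) ?_).inter
      (Units.isOpen.preimage (f := fun X : spAlg Ω => 1 - X.1) ?_)
    · exact continuous_const.add continuous_subtype_val
    · exact continuous_const.sub continuous_subtype_val
  continuousOn_toFun := by
    have hc : Continuous fun g : Sp Ω => g.1.1 :=
      Units.continuous_val.comp continuous_subtype_val
    refine Topology.IsInducing.subtypeVal.continuousOn_iff.2 ?_
    rintro g ⟨u, hu⟩
    refine ContinuousAt.continuousWithinAt ?_
    refine ContinuousAt.mul (hc.sub continuous_const).continuousAt ?_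
    refine ContinuousAt.comp (g := Ring.inverse) (f := fun g : Sp Ω => g.1.1 + 1) ?_
      (hc.add continuous_const).continuousAt
    simp only [← hu]
    have := FiniteDimensional.complete ℝ V
    exact NormedRing.inverse_continuousAt u
  continuousOn_invFun := by
    have := FiniteDimensional.complete ℝ V
    refine Topology.IsInducing.subtypeVal.continuousOn_iff.2 ?_
    refine Units.isOpenEmbedding_val.isInducing.continuousOn_iff.2 ?_
    have hc : Continuous fun X : spAlg Ω => X.1 := continuous_subtype_val
    have : ContinuousOn (fun X : spAlg Ω => (1 + X.1) * Ring.inverse (1 - X.1))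
        {X | IsUnit (1 + X.1) ∧ IsUnit (1 - X.1)} := by
      intro X hX
      obtain ⟨b, hb⟩ := hX.2
      refine ContinuousAt.continuousWithinAt ?_
      refine ContinuousAt.mul (continuous_const.add hc).continuousAt ?_
      refine ContinuousAt.comp (g := Ring.inverse) (f := fun X : spAlg Ω => 1 - X.1) ?_
        (continuous_const.sub hc).continuousAt
      simp only [← hb]
      have := FiniteDimensional.complete ℝ V
      exact NormedRing.inverse_continuousAt b
    exact this.congr fun X hX => cayleyInv_val Ω hX


variable [FiniteDimensional ℝ V]

/-- The chart of `Sp(V)` around `g₀`: the Cayley transform of `g₀⁻¹ g`. -/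
noncomputable def spChart (g₀ : Sp Ω) : OpenPartialHomeomorph (Sp Ω) (spAlg Ω) :=
  (Homeomorph.mulLeft g₀⁻¹).toOpenPartialHomeomorph.trans (cayley Ω)

theorem one_mem_cayley_source : (1 : Sp Ω) ∈ (cayley Ω).source := by
  change IsUnit ((1 : V →L[ℝ] V) + 1)
  rw [one_add_one_eq_two]
  exact isUnit_two

/-- The smooth structure of `Sp(V)` as a Lie group with Lie algebra `𝔰𝔭(V)`. -/
noncomputable instance spChartedSpace : ChartedSpace (spAlg Ω) (Sp Ω) where
  atlas := Set.range (spChart Ω)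
  chartAt := spChart Ω
  mem_chart_source g := by
    refine ⟨trivial, ?_⟩
    have : g⁻¹ * g ∈ (cayley Ω).source := by
      rw [inv_mul_cancel]; exact one_mem_cayley_source Ω
    exact this
  chart_mem_atlas g := ⟨g, rfl⟩

theorem contDiff_submodule {E : Type*} [NormedAddCommGroup E] [NormedSpace ℝ E]
    (S : Submodule ℝ E) [FiniteDimensional ℝ S] (n : ℕ∞ω) :
    ContDiff ℝ n (fun x : S => (x : E)) ∧
      ∃ P : E → S, ContDiff ℝ n P ∧ ∀ x : S, P x = x := by
  obtain ⟨P, hP⟩ := Submodule.ClosedComplemented.of_finiteDimensional (𝕜 := ℝ) S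
  exact ⟨S.subtypeL.contDiff, P, P.contDiff, hP⟩

instance spIsManifold (n : ℕ∞ω) : IsManifold 𝓘(ℝ, spAlg Ω) n (Sp Ω) := by
  have := FiniteDimensional.complete ℝ V
  refine isManifold_of_contDiffOn _ _ _ ?_
  rintro _ _ ⟨g, rfl⟩ ⟨h, rfl⟩
  obtain ⟨hval0, P, hPs, hP⟩ := contDiff_submodule (spAlg Ω) n
  set k : Sp Ω := h⁻¹ * g
  let f : spAlg Ω → (V →L[ℝ] V) := fun X =>
    (k.1.1 * ((1 + X.1) * Ring.inverse (1 - X.1)) - 1) *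
      Ring.inverse (k.1.1 * ((1 + X.1) * Ring.inverse (1 - X.1)) + 1)
  have hf : ∀ X : spAlg Ω, (IsUnit (1 + X.1) ∧ IsUnit (1 - X.1)) →
      IsUnit (k.1.1 * ((1 + X.1) * Ring.inverse (1 - X.1)) + 1) → ContDiffAt ℝ n f X := by
    intro X hX hk
    have hv : ContDiffAt ℝ n (fun X : spAlg Ω => X.1) X := hval0.contDiffAt
    obtain ⟨b, hb⟩ := hX.2
    obtain ⟨c, hc⟩ := hk
    have h1 : ContDiffAt ℝ n (fun X : spAlg Ω => Ring.inverse (1 - X.1)) X := by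
      refine ContDiffAt.comp (g := Ring.inverse) X ?_ (contDiffAt_const.sub hv)
      rw [← hb]; exact contDiffAt_ringInverse ℝ b
    have h2 : ContDiffAt ℝ n (fun X : spAlg Ω => k.1.1 * ((1 + X.1) * Ring.inverse (1 - X.1))) X :=
      contDiffAt_const.mul ((contDiffAt_const.add hv).mul h1)
    refine (h2.sub contDiffAt_const).mul ?_
    refine ContDiffAt.comp (g := Ring.inverse) X ?_ (h2.add contDiffAt_const)
    rw [← hc]; exact contDiffAt_ringInverse ℝ c
  have hval : ∀ X : spAlg Ω, (IsUnit (1 + X.1) ∧ IsUnit (1 - X.1)) →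
      (h⁻¹ * ((g⁻¹)⁻¹ * cayleyInv Ω X) : Sp Ω).1.1 =
        k.1.1 * ((1 + X.1) * Ring.inverse (1 - X.1)) := by
    intro X hX
    rw [inv_inv, ← cayleyInv_val Ω hX, ← mul_assoc]
    rfl
  intro X hX
  have hX1 : IsUnit (1 + X.1) ∧ IsUnit (1 - X.1) := hX.1.1.1
  have hX2 : IsUnit ((h⁻¹ * ((g⁻¹)⁻¹ * cayleyInv Ω X) : Sp Ω).1.1 + 1) := hX.1.2.2
  rw [hval X hX1] at hX2
  have := (hPs.contDiffAt.comp X (hf X hX1 hX2)).contDiffWithinAt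
    (s := 𝓘(ℝ, spAlg Ω).symm ⁻¹' ((spChart Ω g).symm.trans (spChart Ω h)).source ∩
      Set.range 𝓘(ℝ, spAlg Ω))
  have heq : ∀ Y : spAlg Ω, (IsUnit (1 + Y.1) ∧ IsUnit (1 - Y.1)) →
      cayley Ω (h⁻¹ * ((g⁻¹)⁻¹ * cayleyInv Ω Y)) = P (f Y) := by
    intro Y hY
    have : (cayley Ω (h⁻¹ * ((g⁻¹)⁻¹ * cayleyInv Ω Y))).1 = f Y := by
      change ((h⁻¹ * ((g⁻¹)⁻¹ * cayleyInv Ω Y) : Sp Ω).1.1 - 1) *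
        Ring.inverse ((h⁻¹ * ((g⁻¹)⁻¹ * cayleyInv Ω Y) : Sp Ω).1.1 + 1) = f Y
      rw [hval Y hY]
    rw [← this, hP]
  refine this.congr ?_ ?_
  · intro Y hY
    exact heq Y hY.1.1.1
  · exact heq X hX1

end SymplecticGroup

section DoubleCover

variable (G : Type*) [Group G] [TopologicalSpace G] [IsTopologicalGroup G]

/-- The group of continuous paths in `G` starting at `1`, under pointwise multiplication, with the
compact-open topology. -/
def PathGroup : Subgroup C(unitInterval, G) where
  carrier := {p | p 0 = 1}
  mul_mem' := by
    intro p q (hp : p 0 = 1) (hq : q 0 = 1)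
    change p 0 * q 0 = 1
    rw [hp, hq, one_mul]
  one_mem' := rfl
  inv_mem' := by
    intro p (hp : p 0 = 1)
    change (p 0)⁻¹ = 1
    rw [hp, inv_one]

instance : IsTopologicalGroup (PathGroup G) where
  continuous_mul := by
    refine Continuous.subtype_mk ?_ _
    exact (continuous_subtype_val.comp continuous_fst).mul
      (continuous_subtype_val.comp continuous_snd)
  continuous_inv := by
    refine Continuous.subtype_mk ?_ _
    exact (ContinuousMap.continuous_postcomp (⟨fun x => x⁻¹, continuous_inv⟩ : C(G, G))).comp
      continuous_subtype_val

/-- The loops at `1` whose class in `π₁(G, 1)` is a product of squares. It is the (normal) subgroup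
of the path group generated by the loops that are null-homotopic relative to the endpoints and the
squares `t ↦ ℓ(t) ℓ(t)` of loops `ℓ` (such a square is homotopic to the concatenation `ℓ · ℓ`). -/
def squareLoops : Subgroup (PathGroup G) :=
  Subgroup.normalClosure
    ({p | ContinuousMap.HomotopicRel p.1 1 {0, 1}} ∪ {p | ∃ l : PathGroup G, l.1 1 = 1 ∧ p = l * l})

instance : (squareLoops G).Normal := Subgroup.normalClosure_normal

/-- Evaluation of a path at its end point. -/
def endpoint : PathGroup G →* G where
  toFun p := p.1 1
  map_one' := rfl
  map_mul' _ _ := rfl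

theorem squareLoops_le : squareLoops G ≤ (endpoint G).ker := by
  refine Subgroup.normalClosure_le_normal ?_
  rintro p (⟨⟨h⟩⟩ | ⟨l, hl, rfl⟩)
  · have := h.eq_fst 1 (show (1 : unitInterval) ∈ ({0, 1} : Set unitInterval) by simp)
    rw [h.apply_one] at this
    exact this.symm
  · change l.1 1 * l.1 1 = 1
    rw [hl, one_mul]

/-- The connected covering group of (the identity component of) `G` that belongs to the subgroup of
squares of the abelian group `π₁(G, 1)`: paths in `G` starting at `1`, where two paths are
identified if they have the same end point and differ by a loop whose class is a square.
If `π₁(G, 1) ≅ ℤ`, this is the connected double cover. -/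
def SquareCover : Type _ := PathGroup G ⧸ squareLoops G

noncomputable instance : Group (SquareCover G) :=
  inferInstanceAs (Group (PathGroup G ⧸ squareLoops G))

instance : TopologicalSpace (SquareCover G) :=
  inferInstanceAs (TopologicalSpace (PathGroup G ⧸ squareLoops G))

instance : IsTopologicalGroup (SquareCover G) :=
  inferInstanceAs (IsTopologicalGroup (PathGroup G ⧸ squareLoops G))

/-- The covering homomorphism, which sends a path to its end point. -/
noncomputable def SquareCover.proj : SquareCover G →* G :=
  QuotientGroup.lift _ (endpoint G) (squareLoops_le G)

theorem SquareCover.continuous_proj : Continuous (SquareCover.proj G) := by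
  refine Continuous.quotient_lift (f := endpoint G) ?_ _
  exact (continuous_eval_const (1 : unitInterval)).comp continuous_subtype_val

variable {G}

theorem SquareCover.isLocalHomeomorph_proj {E : Type*} [NormedAddCommGroup E] [NormedSpace ℝ E]
    (c : OpenPartialHomeomorph G E) (h1 : (1 : G) ∈ c.source) :
    IsLocalHomeomorph (SquareCover.proj G) := by
  obtain ⟨r, hr, hball⟩ := Metric.isOpen_iff.1 c.open_target (c 1) (c.map_source h1)
  let U : Set G := c.source ∩ c ⁻¹' Metric.ball (c 1) r
  have hUo : IsOpen U := c.isOpen_inter_preimage Metric.isOpen_ball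
  have h1U : (1 : G) ∈ U := ⟨h1, Metric.mem_ball_self hr⟩
  let κ : unitInterval × U → G := fun x => c.symm (AffineMap.lineMap (c 1) (c x.2.1) (x.1 : ℝ))
  have hκc : Continuous κ := by
    refine c.continuousOn_symm.comp_continuous ?_ ?_
    · have : Continuous fun x : unitInterval × U => c x.2.1 :=
        c.continuousOn.comp_continuous (by fun_prop) fun x => x.2.2.1
      simp only [AffineMap.lineMap_apply_module]
      exact ((continuous_const.sub (continuous_subtype_val.comp continuous_fst)).smul
        continuous_const).add ((continuous_subtype_val.comp continuous_fst).smul this)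
    · intro x
      refine hball ((convex_ball (c 1) r).lineMap_mem (Metric.mem_ball_self hr) x.2.2.2 x.1.2)
  have hκ0 : ∀ g, κ (0, g) = 1 := fun g => by simp [κ, c.left_inv h1]
  have hκ1 : ∀ g, κ (1, g) = g := fun g => by simp [κ, c.left_inv g.2.1]
  have hκe : ∀ s, κ (s, ⟨1, h1U⟩) = 1 := fun s => by simp [κ, c.left_inv h1]
  -- loops in `U` are null-homotopic
  have hnull : ∀ p : PathGroup G, (∀ t, p.1 t ∈ U) → p.1 1 = 1 → p ∈ squareLoops G := by
    intro p hp hp1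
    have hp0 : p.1 0 = 1 := p.2
    refine Subgroup.subset_normalClosure (Or.inl ⟨?_⟩)
    refine
      { toFun := fun x => κ (unitInterval.symm x.1, ⟨p.1 x.2, hp x.2⟩)
        continuous_toFun := ?_
        map_zero_left := ?_
        map_one_left := ?_
        prop' := ?_ }
    · refine hκc.comp (Continuous.prodMk (by fun_prop) (Continuous.subtype_mk ?_ _))
      exact p.1.continuous.comp continuous_snd
    · intro t
      simp [hκ1]
    · intro t
      simp [hκ0]
    · rintro s t (rfl | rfl)
      · change κ (unitInterval.symm s, ⟨p.1 0, hp 0⟩) = p.1 0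
        simp only [hp0, hκe]
      · change κ (unitInterval.symm s, ⟨p.1 1, hp 1⟩) = p.1 1
        simp only [hp1, hκe]
  -- a local section
  let s' : C(U, C(unitInterval, G)) :=
    ContinuousMap.curry ⟨fun x => κ (x.2, x.1), hκc.comp continuous_swap⟩
  let s : U → PathGroup G := fun g => ⟨s' g, hκ0 g⟩
  have hs : Continuous s := s'.continuous.subtype_mk _
  have hs1 : s ⟨1, h1U⟩ = 1 := by
    apply Subtype.ext
    ext t
    exact hκe t
  -- a neighbourhood of `1` on which the projection is injective
  have hA : {p : PathGroup G | ∀ t, p.1 t ∈ U} ∈ 𝓝 (1 : PathGroup G) := by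
    have ho : IsOpen {f : C(unitInterval, G) | Set.MapsTo f Set.univ U} :=
      ContinuousMap.isOpen_setOfPred_mapsTo isCompact_univ hUo
    refine Filter.mem_of_superset ((ho.preimage continuous_subtype_val).mem_nhds
      (show (1 : PathGroup G) ∈ _ from fun t _ => h1U)) ?_
    intro p hp t
    exact hp (Set.mem_univ t)
  obtain ⟨W, hW, hWA⟩ : ∃ W ∈ 𝓝 (1 : PathGroup G), ∀ x ∈ W, ∀ y ∈ W, ∀ t, (x⁻¹ * y).1 t ∈ U := by
    have hcont : Filter.Tendsto (fun x : PathGroup G × PathGroup G => x.1⁻¹ * x.2) (𝓝 (1, 1))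
        (𝓝 1) := by
      have : Continuous fun x : PathGroup G × PathGroup G => x.1⁻¹ * x.2 := by fun_prop
      simpa using this.tendsto (1, 1)
    have h2 := hcont hA
    rw [nhds_prod_eq, Filter.mem_map, Filter.mem_prod_same_iff] at h2
    obtain ⟨W, hW, h⟩ := h2
    exact ⟨W, hW, fun x hx y hy => h (Set.mk_mem_prod hx hy)⟩
  refine MonoidHom.isLocalHomeomorph_of_nhds_one _ (SquareCover.continuous_proj G) ?_
    (QuotientGroup.mk '' W) (QuotientGroup.isOpenMap_coe.image_mem_nhds hW) ?_
  · intro T hT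
    have hT' : (fun g => (QuotientGroup.mk (s g) : SquareCover G)) ⁻¹' (SquareCover.proj G ⁻¹' T) ∈
        𝓝 (⟨1, h1U⟩ : U) := by
      refine (QuotientGroup.continuous_mk.comp hs).continuousAt.preimage_mem_nhds ?_
      rw [Function.comp_apply, hs1]
      exact hT
    have h3 := hUo.isOpenMap_subtype_val.image_mem_nhds hT'
    refine Filter.mem_of_superset h3 ?_
    rintro _ ⟨g, hg, rfl⟩
    have : SquareCover.proj G (QuotientGroup.mk (s g)) = g.1 := hκ1 g
    rw [← this]
    exact hg
  · rintro _ ⟨x, hx, rfl⟩ _ ⟨y, hy, rfl⟩ hxy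
    refine QuotientGroup.eq.2 (hnull _ (hWA x hx y hy) ?_)
    have hxy' : x.1 1 = y.1 1 := hxy
    change (x.1 1)⁻¹ * y.1 1 = 1
    rw [hxy', inv_mul_cancel]

end DoubleCover

section MetaplecticC

variable {V : Type*} [NormedAddCommGroup V] [NormedSpace ℝ V] [FiniteDimensional ℝ V]
  (Ω : V [⋀^Fin 2]→L[ℝ] ℝ)

/-- The metaplectic group `Mp(V)`, the connected double cover of `Sp(V)`: for a symplectic vector
space `V ≠ 0` the group `Sp(V)` is connected with `π₁(Sp(V)) ≅ ℤ`, and the squares are the only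
subgroup of index two. (For `V = 0` there is no connected double cover; here `Mp(0)` is trivial, and
`Mpᶜ(0) = U(1)` below.) -/
abbrev Mp : Type _ := SquareCover (Sp Ω)

/-- The covering map `Mp(V) → Sp(V)`. -/
noncomputable abbrev Mp.proj : Mp Ω →* Sp Ω := SquareCover.proj (Sp Ω)

/-- The diagonal copy of `ℤ₂` in `Mp(V) × U(1)`, generated by `(ε, -1)` with `ε` the nontrivial
preimage of the identity in `Mp(V)`. -/
noncomputable def diagonalZ2 : Subgroup (Mp Ω × Circle) :=
  Subgroup.normalClosure {x | Mp.proj Ω x.1 = 1 ∧ x.1 ≠ 1 ∧ (x.2 : ℂ) = -1}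

instance : (diagonalZ2 Ω).Normal := Subgroup.normalClosure_normal

/-- The metaplectic-c group `Mpᶜ(V) = Mp(V) ×_{ℤ₂} U(1)`. -/
abbrev Mpc : Type _ := (Mp Ω × Circle) ⧸ diagonalZ2 Ω

/-- The projection `σ : Mpᶜ(V) → Sp(V)`, `[x, z] ↦ x̄`. -/
noncomputable def Mpc.σ : Mpc Ω →* Sp Ω :=
  QuotientGroup.lift (diagonalZ2 Ω) ((Mp.proj Ω).comp (MonoidHom.fst _ _)) <| by
    refine Subgroup.normalClosure_le_normal (N := MonoidHom.ker _) ?_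
    rintro x ⟨hx, -⟩
    exact hx

/-- The determinant map `η : Mpᶜ(V) → U(1)`, `[x, z] ↦ z ^ 2`. -/
noncomputable def Mpc.η : Mpc Ω →* Circle :=
  QuotientGroup.lift (diagonalZ2 Ω) ((powMonoidHom 2).comp (MonoidHom.snd _ _)) <| by
    refine Subgroup.normalClosure_le_normal (N := MonoidHom.ker _) ?_
    rintro x ⟨-, -, hx⟩
    change x.2 ^ 2 = 1
    ext
    simp [hx]

theorem Mpc.isLocalHomeomorph : IsLocalHomeomorph fun a : Mpc Ω => (Mpc.σ Ω a, Mpc.η Ω a) := by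
  have hp : IsLocalHomeomorph (Mp.proj Ω) :=
    SquareCover.isLocalHomeomorph_proj (cayley Ω) (one_mem_cayley_source Ω)
  have hc := hp.prodMap' isLocalHomeomorph_circle_sq
  refine isLocalHomeomorph_of_comp_quotient (q := (QuotientGroup.mk : Mp Ω × Circle → Mpc Ω))
    QuotientGroup.continuous_mk QuotientGroup.isOpenMap_coe QuotientGroup.mk_surjective ?_ hc
  refine Continuous.prodMk ?_ ?_
  · exact Continuous.quotient_lift (f := fun x : Mp Ω × Circle => Mp.proj Ω x.1)
      (hp.continuous.comp continuous_fst) _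
  · exact Continuous.quotient_lift (f := fun x : Mp Ω × Circle => x.2 ^ 2)
      (continuous_snd.pow 2) _

/-- The model with corners of the Lie group `Mpᶜ(V)`, whose Lie algebra is `𝔰𝔭(V) ⊕ 𝔲(1)`. -/
noncomputable abbrev Mpc.model :
    ModelWithCorners ℝ (spAlg Ω × EuclideanSpace ℝ (Fin 1))
      (ModelProd (spAlg Ω) (EuclideanSpace ℝ (Fin 1))) :=
  𝓘(ℝ, spAlg Ω).prod (𝓡 1)

/-- The smooth structure of `Mpᶜ(V)`: the one for which the covering homomorphism
`(σ, η) : Mpᶜ(V) → Sp(V) × U(1)` is a local diffeomorphism. -/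
noncomputable instance Mpc.chartedSpace :
    ChartedSpace (ModelProd (spAlg Ω) (EuclideanSpace ℝ (Fin 1))) (Mpc Ω) :=
  (Mpc.isLocalHomeomorph Ω).liftChartedSpace

instance Mpc.isManifold (n : ℕ∞ω) : IsManifold (Mpc.model Ω) n (Mpc Ω) := by
  have : IsManifold (𝓡 1) n Circle := .of_le (n := ω) le_top
  exact (Mpc.isLocalHomeomorph Ω).lift_isManifold (Mpc.model Ω) n

end MetaplecticC

/-! ### Differential forms on manifolds -/

section Forms

variable {E : Type*} [NormedAddCommGroup E] [NormedSpace ℝ E]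
  {M : Type*} [TopologicalSpace M] [ChartedSpace E M]
  {E' : Type*} [NormedAddCommGroup E'] [NormedSpace ℝ E']
  {M' : Type*} [TopologicalSpace M'] [ChartedSpace E' M']
  {F : Type*} [NormedAddCommGroup F] [NormedSpace ℝ F] {n : ℕ}

/-- `F`-valued differential `n`-forms (not necessarily smooth) on a manifold modelled on `E`. -/
abbrev DiffForm (E : Type*) [NormedAddCommGroup E] [NormedSpace ℝ E] (M : Type*)
    [TopologicalSpace M] [ChartedSpace E M] (F : Type*) [NormedAddCommGroup F] [NormedSpace ℝ F]
    (n : ℕ) : Type _ :=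
  ∀ x : M, (TangentSpace 𝓘(ℝ, E) x) [⋀^Fin n]→L[ℝ] F

namespace DiffForm

/-- The pullback `f^*α` of a differential form along a map `f`. -/
noncomputable def pullback (f : M → M') (α : DiffForm E' M' F n) : DiffForm E M F n :=
  fun x => (α (f x)).compContinuousLinearMap (mfderiv 𝓘(ℝ, E) 𝓘(ℝ, E') f x)

/-- The expression of a differential form in the chart at `x₀`, as a form on the model space `E`
(meaningful on the target of the chart): the pullback along the inverse of the chart. -/
noncomputable def inChart (α : DiffForm E M F n) (x₀ : M) : E → E [⋀^Fin n]→L[ℝ] F :=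
  fun y => (α ((chartAt E x₀).symm y)).compContinuousLinearMap
    (mfderiv 𝓘(ℝ, E) 𝓘(ℝ, E) (chartAt E x₀).symm y)

/-- A differential form is smooth if its expressions in all charts are smooth. -/
def IsSmooth (α : DiffForm E M F n) : Prop :=
  ∀ x₀ : M, ContDiffOn ℝ ∞ (α.inChart x₀) (chartAt E x₀).target

/-- The exterior derivative of a differential form, computed at `x` in the chart at `x`. -/
noncomputable def d (α : DiffForm E M F n) : DiffForm E M F (n + 1) :=
  fun x => (extDeriv (α.inChart x) (chartAt E x x)).compContinuousLinearMap
    (mfderiv 𝓘(ℝ, E) 𝓘(ℝ, E) (chartAt E x) x)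

end DiffForm

/-- Symplectic forms on a manifold: smooth closed nondegenerate two-forms. -/
structure IsSymplecticForm (ωM : DiffForm E M ℝ 2) : Prop where
  smooth : ωM.IsSmooth
  closed : ωM.d = 0
  nondegenerate : ∀ (x : M) (v : TangentSpace 𝓘(ℝ, E) x),
    (∀ w : TangentSpace 𝓘(ℝ, E) x, ωM x ![v, w] = 0) → v = 0

/-- Symplectic structures on a vector space: nondegenerate alternating bilinear forms. -/
def IsLinearSymplectic (Ω : E [⋀^Fin 2]→L[ℝ] ℝ) : Prop :=
  ∀ v, (∀ w, Ω ![v, w] = 0) → v = 0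

/-- Symplectomorphisms `(M, ωM) → (M', ωM')`: diffeomorphisms with `f^*ωM' = ωM`. -/
def IsSymplectomorphism (ωM : DiffForm E M ℝ 2) (ωM' : DiffForm E' M' ℝ 2)
    (f : M ≃ₘ^∞⟮𝓘(ℝ, E), 𝓘(ℝ, E')⟯ M') : Prop :=
  DiffForm.pullback f ωM' = ωM

end Forms

/-! ### Principal bundles and metaplectic-c prequantizations -/

open scoped RightActions

/-- `π : P → M` is a smooth right principal `G`-bundle: `G` acts smoothly on `P` from the right and
there are local trivializations `U × G ≅ π⁻¹(U)` that are `G`-equivariant over `U`. -/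
structure IsPrincipalBundle {E : Type*} [NormedAddCommGroup E] [NormedSpace ℝ E]
    {M : Type*} [TopologicalSpace M] [ChartedSpace E M]
    {E' : Type*} [NormedAddCommGroup E'] [NormedSpace ℝ E']
    {P : Type*} [TopologicalSpace P] [ChartedSpace E' P]
    {EG : Type*} [NormedAddCommGroup EG] [NormedSpace ℝ EG] {HG : Type*} [TopologicalSpace HG]
    (IG : ModelWithCorners ℝ EG HG) {G : Type*} [Group G] [TopologicalSpace G] [ChartedSpace HG G]
    [MulAction Gᵐᵒᵖ P] (π : P → M) : Prop where
  smooth_action : ContMDiff (𝓘(ℝ, E').prod IG) 𝓘(ℝ, E') ∞ fun x : P × G => x.1 <• x.2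
  locally_trivial : ∀ m : M, ∃ U : Set M, IsOpen U ∧ m ∈ U ∧
    ∃ Φ : PartialDiffeomorph (𝓘(ℝ, E).prod IG) 𝓘(ℝ, E') (M × G) P ∞,
      Φ.source = U ×ˢ Set.univ ∧ Φ.target = π ⁻¹' U ∧
      ∀ u ∈ U, ∀ a : G, π (Φ (u, a)) = u ∧ ∀ b : G, Φ (u, a * b) = Φ (u, a) <• b

section Prequantization

variable {V : Type*} [NormedAddCommGroup V] [NormedSpace ℝ V] [FiniteDimensional ℝ V]
  (Ω : V [⋀^Fin 2]→L[ℝ] ℝ)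
  {E : Type*} [NormedAddCommGroup E] [NormedSpace ℝ E]
  {M : Type*} [TopologicalSpace M] [ChartedSpace E M] (ωM : DiffForm E M ℝ 2)

/-- The fibre `Sp(M, ωM)_m` of the symplectic frame bundle: the linear isomorphisms
`b : V → T_m M` with `b^*ω_m = Ω`. -/
def SpFrame (m : M) : Type _ :=
  {b : V ≃L[ℝ] TangentSpace 𝓘(ℝ, E) m //
    (ωM m).compContinuousLinearMap (b : V →L[ℝ] TangentSpace 𝓘(ℝ, E) m) = Ω}

/-- The symplectic frame bundle `Sp(M, ωM)`; the bundle projection `ρ` to `M` is `Sigma.fst`. -/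
abbrev SpFrameBundle : Type _ := Σ m : M, SpFrame Ω ωM m

variable {Ω ωM} in
/-- The right action of `Sp(V)` on the symplectic frame bundle: `b · g = b ∘ g`. -/
noncomputable def SpFrameBundle.act (b : SpFrameBundle Ω ωM) (g : Sp Ω) : SpFrameBundle Ω ωM :=
  ⟨b.1, (ContinuousLinearEquiv.ofUnit g.1).trans b.2.1, by
    ext v
    have h := congrArg (fun T : V [⋀^Fin 2]→L[ℝ] ℝ => T ![g.1.1 (v 0), g.1.1 (v 1)]) b.2.2
    have hg := g.2 (v 0) (v 1)
    have hv : v = ![v 0, v 1] := by ext i; fin_cases i <;> rfl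
    rw [hv, ← hg]
    refine Eq.trans ?_ h
    simp only [ContinuousAlternatingMap.compContinuousLinearMap_apply]
    congr 1
    ext i
    fin_cases i <;> rfl⟩

/-- The Lie algebra `𝔲(1) = iℝ ⊆ ℂ`. -/
noncomputable abbrev u1 : Submodule ℝ ℂ := skewAdjoint.submodule ℝ ℂ

variable {F : Type*} [NormedAddCommGroup F] [NormedSpace ℝ F]
  (P : Type*) [TopologicalSpace P] [ChartedSpace F P] [MulAction (Mpc Ω)ᵐᵒᵖ P]

variable {P} in
/-- The vector field on `P` that generates the flow `q ↦ q · exp(t α)`, where `α` lies in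
`𝔪𝔭ᶜ(V) = T₁ Mpᶜ(V)`; its value at `q` is the image of `α` under the differential at `1` of the
orbit map `a ↦ q · a`. -/
noncomputable def fundamentalField (α : TangentSpace (Mpc.model Ω) (1 : Mpc Ω)) (q : P) :
    TangentSpace 𝓘(ℝ, F) q :=
  mfderiv (Mpc.model Ω) 𝓘(ℝ, F) (fun a : Mpc Ω => q <• a) 1 α

/-- The differential `η_* : 𝔪𝔭ᶜ(V) → 𝔲(1)` of `η : Mpᶜ(V) → U(1)`, where `U(1) ⊆ ℂ`. -/
noncomputable def etaStar (α : TangentSpace (Mpc.model Ω) (1 : Mpc Ω)) : ℂ :=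
  mfderiv (Mpc.model Ω) 𝓘(ℝ, ℂ) (fun a : Mpc Ω => (Mpc.η Ω a : ℂ)) 1 α

/-- A metaplectic-c structure `(P, Σ)` for `(M, ω)`: a right principal `Mpᶜ(V)`-bundle
`proj : P → M` with a smooth map `frame : P → Sp(M, ω)` over `M` (the map `Σ`) that is equivariant
with respect to `σ`. Smoothness of a map `q ↦ b_q` into the frame bundle means that
`q ↦ b_q v`, as a map into the tangent bundle of `M`, is smooth for every `v : V`. -/
structure MpcStructure [IsManifold 𝓘(ℝ, E) ∞ M] where
  proj : P → M
  isPrincipalBundle : IsPrincipalBundle (Mpc.model Ω) (G := Mpc Ω) (E := E) (E' := F) proj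
  frame : P → SpFrameBundle Ω ωM
  frame_fst : ∀ q, (frame q).1 = proj q
  frame_smooth : ∀ v : V, ContMDiff 𝓘(ℝ, F) 𝓘(ℝ, E).tangent ∞
    fun q => (⟨(frame q).1, (frame q).2.1 v⟩ : TangentBundle 𝓘(ℝ, E) M)
  frame_act : ∀ (q : P) (a : Mpc Ω), frame (q <• a) = (frame q).act (Mpc.σ Ω a)

/-- A metaplectic-c prequantization `(P, Σ, γ)` of `(M, ω)`, with Planck constant `ħ`. -/
structure MpcPrequantization [IsManifold 𝓘(ℝ, E) ∞ M] (ħ : ℝ) extends MpcStructure Ω ωM (F := F) P where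
  γ : DiffForm F P u1 1
  γ_smooth : γ.IsSmooth
  γ_invariant : ∀ a : Mpc Ω, DiffForm.pullback (fun q : P => q <• a) γ = γ
  γ_vertical : ∀ (α : TangentSpace (Mpc.model Ω) (1 : Mpc Ω)) (q : P),
    (γ q ![fundamentalField Ω α q] : ℂ) = 1 / 2 * etaStar Ω α
  γ_curvature : ∀ (q : P) (X Y : TangentSpace 𝓘(ℝ, F) q),
    (γ.d q ![X, Y] : ℂ) =
      1 / (Complex.I * ħ) * (DiffForm.pullback (E := F) (E' := E) proj ωM q ![X, Y] : ℝ)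

end Prequantization

/-! ### Connectedness of the metaplectic-c group -/

section Connectedness

/-! `K` is not assumed equivariant, so its compatibility with the fibres must come from the
one-forms. Since `d` commutes with pullbacks, `K` carries dγ₂ to dγ₁; dividing the curvature
identities by 1/(iħ) gives K^*Π₂^*ω₂ = Π₁^*ω₁ (`pullback_curvature`). If v is vertical for Π₁, then
the right side vanishes on (v, w) for all w. The differentials of `K` and of Π₂ are onto, so d(Π₂ ∘
K)v is ω₂-orthogonal to a whole tangent space, hence zero because ω₂ is nondegenerate.

Thus Π₂ ∘ K has zero derivative along the orbits of Mpᶜ(V). This group is connected, so Π₂ ∘ K is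
constant on the fibres of Π₁ and factors through a map of the bases, which is smooth because Π₁ has
smooth local sections (`IsPrincipalBundle.exists_descent`). The same argument for K⁻¹ yields the
inverse map. Finally K''^*ω₂ and ω₁ have the same pullback along the surjective submersion Π₁, and
such a pullback is injective on forms. -/

instance PathGroup.pathConnectedSpace (G : Type*) [Group G] [TopologicalSpace G]
    [IsTopologicalGroup G] : PathConnectedSpace (PathGroup G) := by
  refine pathConnectedSpace_iff_eq.2 ⟨1, Set.eq_univ_of_forall fun p => ?_⟩
  -- Rescaling the parameter, t ↦ p(st), contracts p to the constant path; the starting point stays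
  -- at 1 because s · 0 = 0.
  let F : C(unitInterval, C(unitInterval, G)) :=
    ContinuousMap.curry ⟨fun x => p.1 (x.1 * x.2), by fun_prop⟩
  have hp : p.1 0 = 1 := p.2
  have hF : ∀ s, F s ∈ PathGroup G := fun s => by
    change p.1 (s * 0) = 1
    rw [mul_zero, hp]
  refine ⟨⟨⟨fun s => ⟨F s, hF s⟩, F.continuous.subtype_mk _⟩, Subtype.ext (ContinuousMap.ext ?_),
    Subtype.ext (ContinuousMap.ext ?_)⟩⟩
  · intro t
    change p.1 (0 * t) = 1
    rw [zero_mul, hp]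
  · intro t
    change p.1 (1 * t) = p.1 t
    rw [one_mul]

/-- A quotient of the path group inherits its connectedness, so nothing about the connectedness or
the fundamental group of `G` is needed. -/
instance SquareCover.connectedSpace (G : Type*) [Group G] [TopologicalSpace G]
    [IsTopologicalGroup G] : ConnectedSpace (SquareCover G) :=
  (QuotientGroup.mk_surjective (s := squareLoops G)).connectedSpace QuotientGroup.continuous_mk

instance Mpc.connectedSpace {V : Type*} [NormedAddCommGroup V] [NormedSpace ℝ V]
    [FiniteDimensional ℝ V] (Ω : V [⋀^Fin 2]→L[ℝ] ℝ) : ConnectedSpace (Mpc Ω) := by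
  have : ConnectedSpace Circle := Circle.exp_surjective.connectedSpace Circle.exp.continuous
  exact (QuotientGroup.mk_surjective (s := diagonalZ2 Ω)).connectedSpace QuotientGroup.continuous_mk

end Connectedness

/-! ### Maps with vanishing differential -/

/-- As `I` has no boundary, a chart target contains a ball around the image of x, which can be taken
so small that `f` sends it into one chart of `M'`. On this convex set the coordinate expression of
`f` has zero derivative and is constant; injectivity of the target chart gives the claim for `f`
itself. -/
theorem isLocallyConstant_of_mfderiv_eq_zero {E H M E' H' M' : Type*}
    [NormedAddCommGroup E] [NormedSpace ℝ E] [TopologicalSpace H] [TopologicalSpace M]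
    [ChartedSpace H M] (I : ModelWithCorners ℝ E H) [I.Boundaryless]
    [NormedAddCommGroup E'] [NormedSpace ℝ E'] [TopologicalSpace H'] [TopologicalSpace M']
    [ChartedSpace H' M'] (I' : ModelWithCorners ℝ E' H') [IsManifold I 1 M] [IsManifold I' 1 M']
    {f : M → M'} (hf : MDifferentiable I I' f) (h0 : ∀ x, mfderiv I I' f x = 0) :
    IsLocallyConstant f := by
  rw [IsLocallyConstant.iff_eventually_eq]
  intro x
  have hs : f ⁻¹' (extChartAt I' (f x)).source ∈ 𝓝 x :=
    hf.continuous.continuousAt.preimage_mem_nhds (extChartAt_source_mem_nhds (I := I') (f x))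
  have hN : (extChartAt I x).symm ⁻¹' (f ⁻¹' (extChartAt I' (f x)).source) ∩
      (extChartAt I x).target ∈ 𝓝 (extChartAt I x x) := by
    refine Filter.inter_mem ?_ (extChartAt_target_mem_nhds x)
    refine (continuousAt_extChartAt_symm x).preimage_mem_nhds ?_
    rwa [extChartAt_to_inv]
  obtain ⟨r, hr, hball⟩ := Metric.mem_nhds_iff.1 hN
  set g : E → E' := fun y => extChartAt I' (f x) (f ((extChartAt I x).symm y)) with hg
  have hd : ∀ y ∈ Metric.ball (extChartAt I x x) r, HasFDerivAt g (0 : E →L[ℝ] E') y := by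
    intro y hy
    obtain ⟨h1, h2⟩ := hball hy
    have a1 := ((contMDiffOn_extChartAt_symm (I := I) (n := 1) x).contMDiffAt
      ((isOpen_extChartAt_target x).mem_nhds h2)).mdifferentiableAt one_ne_zero
    have a2 := (hf ((extChartAt I x).symm y)).hasMFDerivAt
    rw [h0] at a2
    have a3 := ((contMDiffOn_extChartAt (I := I') (n := 1) (x := f x)).contMDiffAt
      ((chartAt H' (f x)).open_source.mem_nhds (by simpa using h1))).mdifferentiableAt one_ne_zero
    have a4 := a3.hasMFDerivAt.comp y (a2.comp y a1.hasMFDerivAt)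
    rw [hasMFDerivAt_iff_hasFDerivAt] at a4
    refine a4.congr_fderiv ?_
    rw [ContinuousLinearMap.zero_comp]
    exact ContinuousLinearMap.comp_zero _
  have hconst : ∀ y ∈ Metric.ball (extChartAt I x x) r, g y = g (extChartAt I x x) := by
    intro y hy
    refine (convex_ball (extChartAt I x x) r).is_const_of_fderivWithin_eq_zero (𝕜 := ℝ)
      (fun z hz => (hd z hz).differentiableAt.differentiableWithinAt) (fun z hz => ?_) hy
      (Metric.mem_ball_self hr)
    rw [fderivWithin_of_isOpen Metric.isOpen_ball hz, (hd z hz).fderiv]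
  filter_upwards [hs, extChartAt_source_mem_nhds (I := I) x,
    (continuousAt_extChartAt (I := I) x).preimage_mem_nhds (Metric.ball_mem_nhds _ hr)]
    with z h1 h2 h3
  have h4 := hconst _ h3
  simp only [hg, extChartAt_to_inv, (extChartAt I x).left_inv h2] at h4
  exact (extChartAt I' (f x)).injOn h1 (mem_extChartAt_source (f x)) h4

/-! ### Naturality of the exterior derivative -/

namespace DiffForm

variable {E : Type*} [NormedAddCommGroup E] [NormedSpace ℝ E]
  {M : Type*} [TopologicalSpace M] [ChartedSpace E M]
  {E' : Type*} [NormedAddCommGroup E'] [NormedSpace ℝ E']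
  {M' : Type*} [TopologicalSpace M'] [ChartedSpace E' M']
  {E'' : Type*} [NormedAddCommGroup E''] [NormedSpace ℝ E'']
  {M'' : Type*} [TopologicalSpace M''] [ChartedSpace E'' M'']
  {F : Type*} [NormedAddCommGroup F] [NormedSpace ℝ F] {n : ℕ}

/-- Every tangent space unfolds to the model space `E`, so one tuple can be inserted at both points.
This moves the base point where a rewrite would meet dependent types. -/
theorem apply_congr_point (α : DiffForm E M F n) {x y : M} (h : x = y) (v : Fin n → E) :
    α x v = α y v := by
  subst h; rfl

theorem pullback_apply (f : M → M') (α : DiffForm E' M' F n) (x : M)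
    (v : Fin n → TangentSpace 𝓘(ℝ, E) x) :
    pullback f α x v = α (f x) (fun i => mfderiv 𝓘(ℝ, E) 𝓘(ℝ, E') f x (v i)) := rfl

theorem pullback_pullback {f : M → M'} {g : M' → M''} (hf : MDifferentiable 𝓘(ℝ, E) 𝓘(ℝ, E') f)
    (hg : MDifferentiable 𝓘(ℝ, E') 𝓘(ℝ, E'') g) (α : DiffForm E'' M'' F n) :
    pullback (E := E) f (pullback (E := E') g α) = pullback (g ∘ f) α := by
  funext x
  ext v
  simp only [pullback_apply]
  rw [mfderiv_comp x (hg _) (hf _)]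
  rfl

theorem pullback_id (α : DiffForm E M F n) : pullback (id : M → M) α = α := by
  funext x
  ext v
  simp only [pullback_apply, mfderiv_id]
  rfl

/-- Both sides are computed in the preferred charts at x and f x, so independence of `d` from the
chart is not needed. There `f` becomes a smooth map g between vector spaces, to which
`extDeriv_pullback` applies; the chain rule for g ∘ c = c' ∘ f translates the result back. -/
theorem d_pullback [IsManifold 𝓘(ℝ, E) ∞ M] [IsManifold 𝓘(ℝ, E') ∞ M'] {f : M → M'}
    (hf : ContMDiff 𝓘(ℝ, E) 𝓘(ℝ, E') ∞ f) {α : DiffForm E' M' F n} (hα : α.IsSmooth) :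
    (pullback (E := E) f α).d = pullback f α.d := by
  funext x
  set c := chartAt E x with hc
  set c' := chartAt E' (f x) with hc'
  set g : E → E' := fun y => c' (f (c.symm y)) with hg
  have hxc : x ∈ c.source := mem_chart_source E x
  have hxc' : f x ∈ c'.source := mem_chart_source E' (f x)
  have hcsymm : c.symm (c x) = x := c.left_inv hxc
  have hgx : g (c x) = c' (f x) := by simp only [hg, hcsymm]
  have hmc : ContMDiffAt 𝓘(ℝ, E) 𝓘(ℝ, E) ∞ c x := contMDiffAt_of_mem_maximalAtlas
    (IsManifold.chart_mem_maximalAtlas x) hxc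
  have hmc' : ∀ z ∈ c'.source, ContMDiffAt 𝓘(ℝ, E') 𝓘(ℝ, E') ∞ c' z := fun z hz =>
    contMDiffAt_of_mem_maximalAtlas (IsManifold.chart_mem_maximalAtlas (f x)) hz
  have hms : ∀ y ∈ c.target, ContMDiffAt 𝓘(ℝ, E) 𝓘(ℝ, E) ∞ c.symm y := fun y hy =>
    contMDiffAt_symm_of_mem_maximalAtlas (IsManifold.chart_mem_maximalAtlas x) hy
  have hms' : ∀ y ∈ c'.target, ContMDiffAt 𝓘(ℝ, E') 𝓘(ℝ, E') ∞ c'.symm y := fun y hy =>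
    contMDiffAt_symm_of_mem_maximalAtlas (IsManifold.chart_mem_maximalAtlas (f x)) hy
  have hgd : ∀ y ∈ c.target, f (c.symm y) ∈ c'.source →
      ContMDiffAt 𝓘(ℝ, E) 𝓘(ℝ, E') ∞ g y := fun y hy hy' =>
    (hmc' _ hy').comp y (hf.contMDiffAt.comp y (hms y hy))
  have hW : ∀ᶠ y in 𝓝 (c x), y ∈ c.target ∧ f (c.symm y) ∈ c'.source := by
    refine Filter.Eventually.and (c.open_target.mem_nhds (c.map_source hxc)) ?_
    refine (hf.continuous.continuousAt.comp (c.continuousAt_symm (c.map_source hxc))).eventually ?_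
    rw [Function.comp_apply, hcsymm]
    exact c'.open_source.mem_nhds hxc'
  have key : (pullback (E := E) f α).inChart x =ᶠ[𝓝 (c x)]
      fun y => (α.inChart (f x) (g y)).compContinuousLinearMap (fderiv ℝ g y) := by
    -- The chart conditions are required on a neighbourhood of y, since `e3` compares derivatives at
    -- y of maps that agree only where these conditions hold.
    filter_upwards [eventually_eventually_nhds.2 hW] with y hyW
    obtain ⟨hy, hy'⟩ := hyW.self_of_nhds
    have e1 : mfderiv 𝓘(ℝ, E) 𝓘(ℝ, E') (c'.symm ∘ g) y =
        (mfderiv 𝓘(ℝ, E') 𝓘(ℝ, E') c'.symm (g y)).comp (mfderiv 𝓘(ℝ, E) 𝓘(ℝ, E') g y) :=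
      mfderiv_comp y ((hms' _ (c'.map_source hy')).mdifferentiableAt (by simp))
        ((hgd y hy hy').mdifferentiableAt (by simp))
    have e2 : mfderiv 𝓘(ℝ, E) 𝓘(ℝ, E') (f ∘ c.symm) y =
        (mfderiv 𝓘(ℝ, E) 𝓘(ℝ, E') f (c.symm y)).comp (mfderiv 𝓘(ℝ, E) 𝓘(ℝ, E) c.symm y) :=
      mfderiv_comp y (hf.mdifferentiable (by simp) _)
        ((hms y hy).mdifferentiableAt (by simp))
    have e3 : mfderiv 𝓘(ℝ, E) 𝓘(ℝ, E') (c'.symm ∘ g) y =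
        mfderiv 𝓘(ℝ, E) 𝓘(ℝ, E') (f ∘ c.symm) y := by
      refine Filter.EventuallyEq.mfderiv_eq ?_
      filter_upwards [hyW] with z hz
      exact c'.left_inv hz.2
    ext v
    change α (f (c.symm y)) (fun i => mfderiv 𝓘(ℝ, E) 𝓘(ℝ, E') f (c.symm y)
        (mfderiv 𝓘(ℝ, E) 𝓘(ℝ, E) c.symm y (v i))) =
      α (c'.symm (g y)) (fun i => mfderiv 𝓘(ℝ, E') 𝓘(ℝ, E') c'.symm (g y) (fderiv ℝ g y (v i)))
    rw [← mfderiv_eq_fderiv]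
    refine (apply_congr_point α (c'.left_inv hy').symm _).trans (congrArg (α (c'.symm (g y))) ?_)
    funext i
    have := congrArg (fun T : E →L[ℝ] E' => T (v i)) (e2.symm.trans (e3.symm.trans e1))
    exact this
  have hgx' : ContDiffAt ℝ ∞ g (c x) := (contMDiffAt_iff_contDiffAt).1
    (hgd _ hW.self_of_nhds.1 hW.self_of_nhds.2)
  have hαd : DifferentiableAt ℝ (α.inChart (f x)) (g (c x)) := by
    rw [hgx]
    exact ((hα (f x)).contDiffAt (c'.open_target.mem_nhds (c'.map_source hxc'))).differentiableAt
      (by simp)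
  have e4 : (fderiv ℝ g (c x)).comp (mfderiv 𝓘(ℝ, E) 𝓘(ℝ, E) c x) =
      (mfderiv 𝓘(ℝ, E') 𝓘(ℝ, E') c' (f x)).comp (mfderiv 𝓘(ℝ, E) 𝓘(ℝ, E') f x) := by
    rw [← mfderiv_eq_fderiv]
    have e5 := mfderiv_comp x
      ((hgd _ hW.self_of_nhds.1 hW.self_of_nhds.2).mdifferentiableAt (by simp))
      (hmc.mdifferentiableAt (by simp))
    have e6 := mfderiv_comp x ((hmc' _ hxc').mdifferentiableAt (by simp))
      (hf.mdifferentiable (by simp) x)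
    refine e5.symm.trans (Eq.trans ?_ e6)
    refine Filter.EventuallyEq.mfderiv_eq ?_
    filter_upwards [c.open_source.mem_nhds hxc] with z hz
    simp only [hg, Function.comp_apply, c.left_inv hz]
  have e7 : extDeriv ((pullback (E := E) f α).inChart x) (c x) =
      (extDeriv (α.inChart (f x)) (c' (f x))).compContinuousLinearMap (fderiv ℝ g (c x)) := by
    -- The exterior derivative depends only on the germ, so the local identity `key` suffices. The
    -- order bound 2 ≤ ∞ provides the symmetric second derivative of g.
    rw [key.extDeriv_eq, extDeriv_pullback hαd hgx'
      (by simpa using (WithTop.coe_le_coe.2 le_top : ((2 : ℕ∞) : ℕ∞ω) ≤ ∞)), hgx]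
  ext v
  change extDeriv ((pullback (E := E) f α).inChart x) (c x)
      (fun i => mfderiv 𝓘(ℝ, E) 𝓘(ℝ, E) c x (v i)) =
    extDeriv (α.inChart (f x)) (c' (f x))
      (fun i => mfderiv 𝓘(ℝ, E') 𝓘(ℝ, E') c' (f x) (mfderiv 𝓘(ℝ, E) 𝓘(ℝ, E') f x (v i)))
  rw [e7]
  refine congrArg (extDeriv (α.inChart (f x)) (c' (f x))) ?_
  funext i
  exact congrArg (fun T : E →L[ℝ] E' => T (v i)) e4

end DiffForm

/-! ### Principal bundles -/

namespace IsPrincipalBundle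

variable {E : Type*} [NormedAddCommGroup E] [NormedSpace ℝ E]
  {M : Type*} [TopologicalSpace M] [ChartedSpace E M]
  {E' : Type*} [NormedAddCommGroup E'] [NormedSpace ℝ E']
  {P : Type*} [TopologicalSpace P] [ChartedSpace E' P]
  {EG : Type*} [NormedAddCommGroup EG] [NormedSpace ℝ EG] {HG : Type*} [TopologicalSpace HG]
  {IG : ModelWithCorners ℝ EG HG} {G : Type*} [Group G] [TopologicalSpace G] [ChartedSpace HG G]
  [MulAction Gᵐᵒᵖ P] {π : P → M}

/-- Over a trivializing set, π is the first component of the inverse trivialization. -/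
theorem contMDiff_proj (hπ : IsPrincipalBundle (E := E) (E' := E') IG (G := G) π) :
    ContMDiff 𝓘(ℝ, E') 𝓘(ℝ, E) ∞ π := by
  intro q
  obtain ⟨U, hU, hqU, Φ, hs, ht, hΦ⟩ := hπ.locally_trivial (π q)
  have hq : Φ.target ∈ 𝓝 q := Φ.open_target.mem_nhds (by rw [ht]; exact hqU)
  have h1 : ContMDiffAt 𝓘(ℝ, E') 𝓘(ℝ, E) ∞ (fun p => (Φ.invFun p).1) q :=
    (Φ.contMDiffOn_invFun.contMDiffAt hq).fst
  refine h1.congr_of_eventuallyEq ?_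
  filter_upwards [hq] with p hp
  have h2 : Φ.invFun p ∈ Φ.source := Φ.map_target hp
  rw [hs] at h2
  have h3 : Φ.toFun (Φ.invFun p) = p := Φ.right_inv hp
  rw [← (hΦ _ h2.1 (Φ.invFun p).2).1]
  exact congrArg π h3.symm

/-- Through every point of the total space there is a local section. -/
theorem exists_section (hπ : IsPrincipalBundle (E := E) (E' := E') IG (G := G) π) (q : P) :
    ∃ s : M → P, ContMDiffAt 𝓘(ℝ, E) 𝓘(ℝ, E') ∞ s (π q) ∧ s (π q) = q ∧
      ∀ᶠ m in 𝓝 (π q), π (s m) = m := by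
  obtain ⟨U, hU, hqU, Φ, hs, ht, hΦ⟩ := hπ.locally_trivial (π q)
  have hq : q ∈ Φ.target := by rw [ht]; exact hqU
  have h3 : Φ (Φ.invFun q) = q := Φ.right_inv hq
  have h2 : Φ.invFun q ∈ Φ.source := Φ.map_target hq
  rw [hs] at h2
  have h4 : (Φ.invFun q).1 = π q := by
    rw [← (hΦ _ h2.1 (Φ.invFun q).2).1]
    exact congrArg π h3
  refine ⟨fun m => Φ (m, (Φ.invFun q).2), ?_, ?_, ?_⟩
  · have h5 : ContMDiffAt (𝓘(ℝ, E).prod IG) 𝓘(ℝ, E') ∞ Φ (π q, (Φ.invFun q).2) :=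
      Φ.contMDiffOn.contMDiffAt (Φ.open_source.mem_nhds (by rw [hs]; exact ⟨hqU, trivial⟩))
    exact h5.comp (π q) (contMDiffAt_id.prodMk contMDiffAt_const)
  · rw [← h4]
    exact h3
  · filter_upwards [hU.mem_nhds hqU] with m hm using (hΦ m hm _).1

theorem surjective (hπ : IsPrincipalBundle (E := E) (E' := E') IG (G := G) π) :
    Function.Surjective π := by
  intro m
  obtain ⟨U, hU, hm, Φ, hs, ht, hΦ⟩ := hπ.locally_trivial m
  exact ⟨_, (hΦ m hm 1).1⟩

/-- The differential of a local section through q is a right inverse. -/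
theorem mfderiv_surjective (hπ : IsPrincipalBundle (E := E) (E' := E') IG (G := G) π) (q : P) :
    Function.Surjective (mfderiv 𝓘(ℝ, E') 𝓘(ℝ, E) π q) := by
  obtain ⟨s, hs, hsq, hsec⟩ := hπ.exists_section q
  have h1 : HasMFDerivAt 𝓘(ℝ, E) 𝓘(ℝ, E) (π ∘ s) (π q) (ContinuousLinearMap.id ℝ E) :=
    (hasMFDerivAt_id (π q)).congr_of_eventuallyEq hsec
  have h2 : mfderiv 𝓘(ℝ, E) 𝓘(ℝ, E) (π ∘ s) (π q) =
      (mfderiv 𝓘(ℝ, E') 𝓘(ℝ, E) π (s (π q))).comp (mfderiv 𝓘(ℝ, E) 𝓘(ℝ, E') s (π q)) :=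
    mfderiv_comp _ (hπ.contMDiff_proj.mdifferentiable (by simp) _)
      (hs.mdifferentiableAt (by simp))
  rw [h1.mfderiv, hsq] at h2
  intro v
  exact ⟨mfderiv 𝓘(ℝ, E) 𝓘(ℝ, E') s (π q) v, congrArg (fun T : E →L[ℝ] E => T v) h2.symm⟩

theorem proj_act (hπ : IsPrincipalBundle (E := E) (E' := E') IG (G := G) π) (q : P) (a : G) :
    π (q <• a) = π q := by
  obtain ⟨U, hU, hqU, Φ, hs, ht, hΦ⟩ := hπ.locally_trivial (π q)
  have hq : q ∈ Φ.target := by rw [ht]; exact hqU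
  have h2 : Φ.invFun q ∈ Φ.source := Φ.map_target hq
  rw [hs] at h2
  have h3 : Φ ((Φ.invFun q).1, (Φ.invFun q).2) = q := Φ.right_inv hq
  have h4 := (hΦ _ h2.1 (Φ.invFun q).2).2 a
  rw [h3] at h4
  rw [← h4, (hΦ _ h2.1 _).1, ← (hΦ _ h2.1 (Φ.invFun q).2).1, h3]

/-- In a trivialization the two points have coordinates (u, a) and (u, b), and right multiplication
by a⁻¹b takes one to the other. -/
theorem exists_act_eq (hπ : IsPrincipalBundle (E := E) (E' := E') IG (G := G) π) {q q' : P}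
    (h : π q = π q') : ∃ a : G, q <• a = q' := by
  obtain ⟨U, hU, hqU, Φ, hs, ht, hΦ⟩ := hπ.locally_trivial (π q)
  have key : ∀ p, π p = π q → ∃ a, Φ (π q, a) = p := by
    intro p hp
    have hpt : p ∈ Φ.target := by rw [ht]; exact (congrArg (· ∈ U) hp).mpr hqU
    have h2 : Φ.invFun p ∈ Φ.source := Φ.map_target hpt
    rw [hs] at h2
    have h3 : Φ ((Φ.invFun p).1, (Φ.invFun p).2) = p := Φ.right_inv hpt
    refine ⟨(Φ.invFun p).2, ?_⟩
    have h4 := (hΦ _ h2.1 (Φ.invFun p).2).1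
    rw [h3, hp] at h4
    rw [h4, h3]
  obtain ⟨a, ha⟩ := key q rfl
  obtain ⟨b, hb⟩ := key q' h.symm
  refine ⟨a⁻¹ * b, ?_⟩
  have h5 := (hΦ _ hqU a).2 (a⁻¹ * b)
  rw [mul_inv_cancel_left, ha, hb] at h5
  exact h5.symm

/-- A smooth map on the total space of a principal bundle with connected structure group whose
differential kills the vertical vectors descends to a smooth map on the base. -/
theorem exists_descent [IG.Boundaryless] [IsManifold IG 1 G] [PreconnectedSpace G]
    {EN : Type*} [NormedAddCommGroup EN] [NormedSpace ℝ EN] {HN : Type*} [TopologicalSpace HN]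
    {IN : ModelWithCorners ℝ EN HN} {N : Type*} [TopologicalSpace N] [ChartedSpace HN N]
    [IsManifold IN 1 N] (hπ : IsPrincipalBundle (E := E) (E' := E') IG (G := G) π) {f : P → N}
    (hf : ContMDiff 𝓘(ℝ, E') IN ∞ f)
    (hker : ∀ q v, mfderiv 𝓘(ℝ, E') 𝓘(ℝ, E) π q v = 0 → mfderiv 𝓘(ℝ, E') IN f q v = 0) :
    ∃ g : M → N, ContMDiff 𝓘(ℝ, E) IN ∞ g ∧ ∀ q, f q = g (π q) := by
  have horb : ∀ q : P, ContMDiff IG 𝓘(ℝ, E') ∞ fun a : G => q <• a := fun q =>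
    hπ.smooth_action.comp (contMDiff_const.prodMk contMDiff_id)
  -- Since π is constant on orbits, the orbit map has vertical derivative, which `hker` says is
  -- killed by the differential of `f`. Connectedness of `G` then allows comparison of a with 1.
  have hconst : ∀ (q : P) (a : G), f (q <• a) = f q := by
    intro q a
    have h1 : IsLocallyConstant fun a : G => f (q <• a) := by
      refine isLocallyConstant_of_mfderiv_eq_zero IG IN
        ((hf.comp (horb q)).mdifferentiable (by simp)) fun b => ?_
      have e1 : mfderiv IG IN (f ∘ fun a : G => q <• a) b = _ :=
        mfderiv_comp b (hf.mdifferentiable (by simp) _) ((horb q).mdifferentiable (by simp) b)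
      have e2 : mfderiv IG 𝓘(ℝ, E) (π ∘ fun a : G => q <• a) b = _ :=
        mfderiv_comp b (hπ.contMDiff_proj.mdifferentiable (by simp) _)
          ((horb q).mdifferentiable (by simp) b)
      have e3 : (π ∘ fun a : G => q <• a) = fun _ => π q := funext fun a => hπ.proj_act q a
      rw [e3, mfderiv_const] at e2
      refine e1.trans ?_
      ext v
      refine hker _ _ ?_
      exact (congrArg (fun T : EG →L[ℝ] E => T v) e2).symm
    have := h1.apply_eq_of_preconnectedSpace a 1
    simpa using this
  -- The section `r` is arbitrary and possibly discontinuous. Constancy on fibres makes `f ∘ r`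
  -- independent of it, so near each point a smooth local section may replace it.
  choose r hr using hπ.surjective
  have hfac : ∀ q, f q = f (r (π q)) := by
    intro q
    obtain ⟨a, ha⟩ := hπ.exists_act_eq (hr (π q))
    rw [← hconst (r (π q)) a, ha]
  refine ⟨fun m => f (r m), fun m => ?_, hfac⟩
  obtain ⟨s, hs, -, hsec⟩ := hπ.exists_section (r m)
  rw [hr] at hs hsec
  refine (hf.contMDiffAt.comp m hs).congr_of_eventuallyEq ?_
  filter_upwards [hsec] with x hx
  rw [Function.comp_apply, hfac (s x), hx]

end IsPrincipalBundle

/-! ### Metaplectic-c prequantizations -/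

namespace MpcPrequantization

variable {ħ : ℝ} {V : Type*} [NormedAddCommGroup V] [NormedSpace ℝ V] [FiniteDimensional ℝ V]
  {Ω : V [⋀^Fin 2]→L[ℝ] ℝ}
  {E₁ : Type*} [NormedAddCommGroup E₁] [NormedSpace ℝ E₁]
  {M₁ : Type*} [TopologicalSpace M₁] [ChartedSpace E₁ M₁] [IsManifold 𝓘(ℝ, E₁) ∞ M₁]
  {ω₁ : DiffForm E₁ M₁ ℝ 2}
  {E₂ : Type*} [NormedAddCommGroup E₂] [NormedSpace ℝ E₂]
  {M₂ : Type*} [TopologicalSpace M₂] [ChartedSpace E₂ M₂] [IsManifold 𝓘(ℝ, E₂) ∞ M₂]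
  {ω₂ : DiffForm E₂ M₂ ℝ 2}
  {F₁ : Type*} [NormedAddCommGroup F₁] [NormedSpace ℝ F₁]
  {P₁ : Type*} [TopologicalSpace P₁] [ChartedSpace F₁ P₁] [IsManifold 𝓘(ℝ, F₁) ∞ P₁]
  [MulAction (Mpc Ω)ᵐᵒᵖ P₁] (S₁ : MpcPrequantization Ω ω₁ (F := F₁) P₁ ħ)
  {F₂ : Type*} [NormedAddCommGroup F₂] [NormedSpace ℝ F₂]
  {P₂ : Type*} [TopologicalSpace P₂] [ChartedSpace F₂ P₂] [IsManifold 𝓘(ℝ, F₂) ∞ P₂]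
  [MulAction (Mpc Ω)ᵐᵒᵖ P₂] (S₂ : MpcPrequantization Ω ω₂ (F := F₂) P₂ ħ)

/-- A diffeomorphism that preserves the prequantum one-forms preserves the pulled back symplectic
forms. -/
theorem pullback_curvature (hħ : ħ ≠ 0) (K : P₁ ≃ₘ^∞⟮𝓘(ℝ, F₁), 𝓘(ℝ, F₂)⟯ P₂)
    (hK : DiffForm.pullback K S₂.γ = S₁.γ) :
    DiffForm.pullback (E := F₁) K (DiffForm.pullback (E := F₂) S₂.proj ω₂) =
      DiffForm.pullback (E := F₁) S₁.proj ω₁ := by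
  have hd := DiffForm.d_pullback K.contMDiff S₂.γ_smooth
  have hd' : DiffForm.pullback (E := F₁) K S₂.γ.d = S₁.γ.d := by
    rw [← hK]; exact hd.symm
  funext q
  ext v
  have hv : v = ![v 0, v 1] := by ext i; fin_cases i <;> rfl
  have h1 := S₁.γ_curvature q (v 0) (v 1)
  have h2 := S₂.γ_curvature (K q) (mfderiv 𝓘(ℝ, F₁) 𝓘(ℝ, F₂) K q (v 0))
    (mfderiv 𝓘(ℝ, F₁) 𝓘(ℝ, F₂) K q (v 1))
  have hw : (fun i => mfderiv 𝓘(ℝ, F₁) 𝓘(ℝ, F₂) K q (v i)) =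
      ![mfderiv 𝓘(ℝ, F₁) 𝓘(ℝ, F₂) K q (v 0), mfderiv 𝓘(ℝ, F₁) 𝓘(ℝ, F₂) K q (v 1)] := by
    ext i; fin_cases i <;> rfl
  rw [← hv, ← hd', DiffForm.pullback_apply, hw, h2] at h1
  -- The curvature identities hold in ℂ; cancelling this factor leaves an equality of real numbers.
  have hne : (1 : ℂ) / (Complex.I * ħ) ≠ 0 :=
    one_div_ne_zero (mul_ne_zero Complex.I_ne_zero (Complex.ofReal_ne_zero.2 hħ))
  have h3 := Complex.ofReal_injective (mul_left_cancel₀ hne h1)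
  rw [DiffForm.pullback_apply, hw]
  exact h3

/-- A diffeomorphism that preserves the prequantum one-forms descends to a smooth map of the
bases. -/
theorem exists_descent (hħ : ħ ≠ 0) (hω₂ : IsSymplecticForm ω₂)
    (K : P₁ ≃ₘ^∞⟮𝓘(ℝ, F₁), 𝓘(ℝ, F₂)⟯ P₂) (hK : DiffForm.pullback K S₂.γ = S₁.γ) :
    ∃ f : M₁ → M₂, ContMDiff 𝓘(ℝ, E₁) 𝓘(ℝ, E₂) ∞ f ∧ ∀ q, S₂.proj (K q) = f (S₁.proj q) := by
  have hπ₁ := S₁.isPrincipalBundle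
  have hπ₂ := S₂.isPrincipalBundle
  have : IsManifold 𝓘(ℝ, E₂) 1 M₂ := .of_le (n := ∞) (by simp)
  refine hπ₁.exists_descent (hπ₂.contMDiff_proj.comp K.contMDiff) fun q v hv => ?_
  have hcomp : mfderiv 𝓘(ℝ, F₁) 𝓘(ℝ, E₂) (S₂.proj ∘ K) q = _ :=
    mfderiv_comp q (hπ₂.contMDiff_proj.mdifferentiable (by simp) _)
      (K.contMDiff.mdifferentiable (by simp) q)
  refine (congrArg (fun T : F₁ →L[ℝ] E₂ => T v) hcomp).trans ?_
  refine hω₂.nondegenerate _ _ fun w => ?_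
  -- Lifting w through the differentials of Π₂ and `K` turns its pairing with d(Π₂ ∘ K)v into the
  -- value of Π₁^*ω₁ on (v, w''), which is zero because v is vertical.
  obtain ⟨w', hw'⟩ := hπ₂.mfderiv_surjective (K q) w
  obtain ⟨w'', hw''⟩ := (K.mfderivToContinuousLinearEquiv (by simp) q).surjective w'
  have h1 := congrArg (fun T : F₁ [⋀^Fin 2]→L[ℝ] ℝ => T ![v, w''])
    (congrFun (S₁.pullback_curvature S₂ hħ K hK) q)
  have h2 : DiffForm.pullback (E := F₁) S₁.proj ω₁ q ![v, w''] = 0 := by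
    rw [DiffForm.pullback_apply]
    exact (ω₁ (S₁.proj q)).map_coord_zero (0 : Fin 2) hv
  refine Eq.trans ?_ (h1.trans h2)
  refine congrArg (ω₂ (S₂.proj (K q))) ?_
  ext i
  fin_cases i
  · rfl
  · exact (hw'.symm.trans (congrArg (mfderiv 𝓘(ℝ, F₂) 𝓘(ℝ, E₂) S₂.proj (K q)) hw''.symm))

theorem pullback_symm (K : P₁ ≃ₘ^∞⟮𝓘(ℝ, F₁), 𝓘(ℝ, F₂)⟯ P₂)
    (hK : DiffForm.pullback K S₂.γ = S₁.γ) : DiffForm.pullback K.symm S₁.γ = S₂.γ := by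
  rw [← hK, DiffForm.pullback_pullback (K.symm.contMDiff.mdifferentiable (by simp))
    (K.contMDiff.mdifferentiable (by simp))]
  have : (K ∘ K.symm : P₂ → P₂) = id := funext K.apply_symm_apply
  rw [this, DiffForm.pullback_id]

end MpcPrequantization

/-! ### The induced symplectomorphism of the bases -/

theorem mainTheorem5 {n : ℕ} {ħ : ℝ} (hħ : ħ ≠ 0)
    {V : Type*} [NormedAddCommGroup V] [NormedSpace ℝ V] [FiniteDimensional ℝ V]
    (hV : Module.finrank ℝ V = 2 * n) (Ω : V [⋀^Fin 2]→L[ℝ] ℝ) (hΩ : IsLinearSymplectic Ω)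
    {E₁ : Type*} [NormedAddCommGroup E₁] [NormedSpace ℝ E₁] [FiniteDimensional ℝ E₁]
    (hE₁ : Module.finrank ℝ E₁ = 2 * n)
    {M₁ : Type*} [TopologicalSpace M₁] [ChartedSpace E₁ M₁] [IsManifold 𝓘(ℝ, E₁) ∞ M₁]
    (ω₁ : DiffForm E₁ M₁ ℝ 2) (hω₁ : IsSymplecticForm ω₁)
    {E₂ : Type*} [NormedAddCommGroup E₂] [NormedSpace ℝ E₂] [FiniteDimensional ℝ E₂]
    (hE₂ : Module.finrank ℝ E₂ = 2 * n)
    {M₂ : Type*} [TopologicalSpace M₂] [ChartedSpace E₂ M₂] [IsManifold 𝓘(ℝ, E₂) ∞ M₂]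
    (ω₂ : DiffForm E₂ M₂ ℝ 2) (hω₂ : IsSymplecticForm ω₂)
    {F₁ : Type*} [NormedAddCommGroup F₁] [NormedSpace ℝ F₁] [FiniteDimensional ℝ F₁]
    {P₁ : Type*} [TopologicalSpace P₁] [ChartedSpace F₁ P₁] [IsManifold 𝓘(ℝ, F₁) ∞ P₁]
    [MulAction (Mpc Ω)ᵐᵒᵖ P₁] (S₁ : MpcPrequantization Ω ω₁ (F := F₁) P₁ ħ)
    {F₂ : Type*} [NormedAddCommGroup F₂] [NormedSpace ℝ F₂] [FiniteDimensional ℝ F₂]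
    {P₂ : Type*} [TopologicalSpace P₂] [ChartedSpace F₂ P₂] [IsManifold 𝓘(ℝ, F₂) ∞ P₂]
    [MulAction (Mpc Ω)ᵐᵒᵖ P₂] (S₂ : MpcPrequantization Ω ω₂ (F := F₂) P₂ ħ)
    (K : P₁ ≃ₘ^∞⟮𝓘(ℝ, F₁), 𝓘(ℝ, F₂)⟯ P₂) (hK : DiffForm.pullback K S₂.γ = S₁.γ) :
    ∃ K'' : M₁ ≃ₘ^∞⟮𝓘(ℝ, E₁), 𝓘(ℝ, E₂)⟯ M₂,
      (∀ q : P₁, S₂.proj (K q) = K'' (S₁.proj q)) ∧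
      (∀ f : M₁ → M₂, (∀ q : P₁, S₂.proj (K q) = f (S₁.proj q)) → f = K'') ∧
      IsSymplectomorphism ω₁ ω₂ K'' := by
  have hπ₁ := S₁.isPrincipalBundle
  have hπ₂ := S₂.isPrincipalBundle
  obtain ⟨f, hf, hfK⟩ := S₁.exists_descent S₂ hħ hω₂ K hK
  obtain ⟨g, hg, hgK⟩ := S₂.exists_descent S₁ hħ hω₁ K.symm (S₁.pullback_symm S₂ K hK)
  -- The two descended maps are mutually inverse because `K` and `K.symm` are and both projections
  -- are onto.
  have hgf : ∀ m, g (f m) = m := fun m => by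
    obtain ⟨q, rfl⟩ := hπ₁.surjective m
    rw [← hfK, ← hgK, K.symm_apply_apply]
  have hfg : ∀ m, f (g m) = m := fun m => by
    obtain ⟨q, rfl⟩ := hπ₂.surjective m
    rw [← hgK, ← hfK, K.apply_symm_apply]
  refine ⟨⟨⟨f, g, hgf, hfg⟩, hf, hg⟩, hfK, fun f' hf' => ?_, ?_⟩
  · funext m
    obtain ⟨q, rfl⟩ := hπ₁.surjective m
    exact (hf' q).symm.trans (hfK q)
  · change DiffForm.pullback f ω₂ = ω₁
    have hp₁ := hπ₁.contMDiff_proj.mdifferentiable (by simp)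
    have h1 : DiffForm.pullback (E := F₁) S₁.proj (DiffForm.pullback (E := E₁) f ω₂) =
        DiffForm.pullback (E := F₁) S₁.proj ω₁ := by
      rw [← S₁.pullback_curvature S₂ hħ K hK,
        DiffForm.pullback_pullback hp₁ (hf.mdifferentiable (by simp)),
        DiffForm.pullback_pullback (K.contMDiff.mdifferentiable (by simp))
          (hπ₂.contMDiff_proj.mdifferentiable (by simp))]
      exact congrArg (fun h : P₁ → M₂ => DiffForm.pullback (E := F₁) h ω₂) (funext hfK).symm
    funext m
    obtain ⟨q, rfl⟩ := hπ₁.surjective m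
    ext v
    -- Tangent vectors of the base lift to the total space, so equality of the pullbacks to `P₁`
    -- forces equality of the forms.
    choose w hw using fun i => hπ₁.mfderiv_surjective q (v i)
    have h2 := congrArg (fun T : F₁ [⋀^Fin 2]→L[ℝ] ℝ => T w) (congrFun h1 q)
    have h3 : (fun i => mfderiv 𝓘(ℝ, F₁) 𝓘(ℝ, E₁) S₁.proj q (w i)) = v := funext hw
    rw [← h3]
    exact h2
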